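/- All graphs are finite and simple. The claw is $K_{1,3}$, the paw is a triangle with one pendant edge attached to one of its vertices, and the co-paw is the complement of the paw, that is, the disjoint union of a path on three vertices and an isolated vertex. A graph is (claw, co-paw)-free if it has no induced subgraph isomorphic to the claw and none isomorphic to the co-paw. For a graph $G$ with vertex set $V$, the chromatic symmetric function is the formal power series $$X_G=\sum_{\kappa}\ \prod_{v\in V} x_{\kappa(v)}$$ in the variables $x_1,x_2,\dots$, where the sum is over all proper colorings of $G$, i.e. all maps $\kappa:V\to\{1,2,3,\dots\}$ with $\kappa(u)\ne\kappa(v)$ whenever $u$ and $v$ are adjacent. For a partition $\lambda=(\lambda_1,\dots,\lambda_\ell)$ put $e_\lambda=e_{\lambda_1}\cdots e_{\lambda_\ell}$, where $e_k=\sum_{j_1<\dots<j_k}x_{j_1}\cdots x_{j_k}$; for the empty partition $e_\emptyset=1$. A symmetric function is $e$-positive if it is a (finite) linear combination of the $e_\lambda$ with nonnegative rational coefficients. **Theorem.** If $G$ is a (claw, co-paw)-free graph, then $X_G$ is $e$-positive. -/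

import Mathlib

/-- The claw `K_{1,3}`. -/
def clawGraph : SimpleGraph (Fin 1 ⊕ Fin 3) := completeBipartiteGraph (Fin 1) (Fin 3)

/-- The paw: a triangle `0, 1, 2` with a pendant vertex `3` attached to `2`. -/
def pawGraph : SimpleGraph (Fin 4) :=
  SimpleGraph.fromEdgeSet {s(0, 1), s(1, 2), s(0, 2), s(2, 3)}

/-- The co-paw, i.e. the disjoint union of a path on three vertices and a single vertex. -/
def coPawGraph : SimpleGraph (Fin 4) := pawGraphᶜ

/-- `G` has no induced subgraph isomorphic to `H`. -/
def InducedFree {W V : Type*} (H : SimpleGraph W) (G : SimpleGraph V) : Prop :=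
  ¬ H.IsIndContained G

/-- The formal sum `∑_i x^(f i)` of monomials in the variables `x_1, x_2, …`, as a formal power
series: the coefficient of `x^d` is the number of indices `i` with `f i = d`. It is meant for
families with finite fibres, see `hasSum_monomialSum`. -/
noncomputable def monomialSum {ι : Type*} (f : ι → (ℕ+ →₀ ℕ)) : MvPowerSeries ℕ+ ℚ :=
  fun d => (Nat.card {i : ι // f i = d} : ℚ)

/-- The exponent of the monomial `∏ v, x_{κ v}`. -/
noncomputable def colorExponent {V : Type*} [Fintype V] (κ : V → ℕ+) : ℕ+ →₀ ℕ :=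
  ∑ v, Finsupp.single (κ v) 1

/-- The chromatic symmetric function `X_G = ∑_κ ∏_v x_{κ v}`, the sum being over all proper
colorings `κ` of `G` by positive integers. -/
noncomputable def chromaticSymm {V : Type*} [Fintype V] (G : SimpleGraph V) :
    MvPowerSeries ℕ+ ℚ :=
  monomialSum fun κ : G.Coloring ℕ+ => colorExponent (V := V) κ

/-- The elementary symmetric function `e_k = ∑_{j_1 < ⋯ < j_k} x_{j_1} ⋯ x_{j_k}`, the sum being
over all sets of `k` positive integers. -/
noncomputable def elemSymm (k : ℕ) : MvPowerSeries ℕ+ ℚ :=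
  monomialSum fun s : {s : Finset ℕ+ // s.card = k} => ∑ j ∈ s.1, Finsupp.single j 1

/-- `e_λ`, the product of the `e_k` over the parts `k` of the partition `λ`. -/
noncomputable def elemSymmPart {n : ℕ} (p : n.Partition) : MvPowerSeries ℕ+ ℚ :=
  (p.parts.map elemSymm).prod

/-- `f` is a (finite) linear combination of the `e_λ` with nonnegative coefficients. -/
def EPositive (f : MvPowerSeries ℕ+ ℚ) : Prop :=
  ∃ c : (Σ n : ℕ, n.Partition) →₀ ℚ,
    (∀ p, 0 ≤ c p) ∧ f = c.sum fun p a => a • elemSymmPart p.2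

/-- The monomials of a family with finite fibres do sum to `monomialSum` (coefficientwise, with
the discrete topology on the coefficients). -/
theorem hasSum_monomialSum {ι : Type*} (f : ι → (ℕ+ →₀ ℕ)) (hf : ∀ d, {i | f i = d}.Finite) :
    letI : TopologicalSpace ℚ := ⊥
    letI := MvPowerSeries.WithPiTopology.instTopologicalSpace (σ := ℕ+) (R := ℚ)
    HasSum (fun i => (MvPowerSeries.monomial (f i) (1 : ℚ))) (monomialSum f) := by
  classical
  let : TopologicalSpace ℚ := ⊥
  let := MvPowerSeries.WithPiTopology.instTopologicalSpace (σ := ℕ+) (R := ℚ)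
  refine Pi.hasSum.2 fun d => ?_
  have h : monomialSum f d = ∑ i ∈ (hf d).toFinset, MvPowerSeries.monomial (f i) (1 : ℚ) d := by
    have h1 : ∀ i ∈ (hf d).toFinset, MvPowerSeries.monomial (f i) (1 : ℚ) d = 1 := by
      intro i hi
      have hi' : f i = d := by simpa using hi
      change MvPowerSeries.coeff d (MvPowerSeries.monomial (f i) (1 : ℚ)) = 1
      rw [MvPowerSeries.coeff_monomial, if_pos hi'.symm]
    rw [Finset.sum_congr rfl h1, Finset.sum_const, nsmul_eq_mul, mul_one,
      ← Set.ncard_eq_toFinset_card _ (hf d)]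
    rfl
  rw [h]
  refine hasSum_sum_of_ne_finset_zero fun i hi => ?_
  have hi' : f i ≠ d := by simpa using hi
  change MvPowerSeries.coeff d (MvPowerSeries.monomial (f i) (1 : ℚ)) = 0
  rw [MvPowerSeries.coeff_monomial, if_neg (Ne.symm hi')]

/-- Only finitely many colorings have a given monomial. -/
theorem finite_colorExponent {V : Type*} [Fintype V] (G : SimpleGraph V) (d : ℕ+ →₀ ℕ) :
    {κ : G.Coloring ℕ+ | colorExponent (V := V) κ = d}.Finite := by
  classical
  have h : (Set.pi Set.univ fun _ : V => (d.support : Set ℕ+)).Finite :=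
    Set.Finite.pi fun _ => d.support.finite_toSet
  refine Set.Finite.of_finite_image (f := fun κ : G.Coloring ℕ+ => (κ : V → ℕ+))
    (h.subset ?_) (DFunLike.coe_injective.injOn)
  rintro _ ⟨κ, hκ, rfl⟩ v -
  have hκ' : colorExponent (V := V) κ = d := hκ
  simp only [Finset.mem_coe, Finsupp.mem_support_iff, ← hκ', colorExponent, Finsupp.finsetSum_apply]
  intro h0
  have := (Finset.sum_eq_zero_iff.1 h0) v (Finset.mem_univ v)
  simp at this

/-- Distinct sets give distinct monomials. -/
theorem finite_elemSymm (k : ℕ) (d : ℕ+ →₀ ℕ) :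
    {s : {s : Finset ℕ+ // s.card = k} |
      (∑ j ∈ s.1, Finsupp.single j 1 : ℕ+ →₀ ℕ) = d}.Finite := by
  classical
  refine Set.Subsingleton.finite fun s hs t ht => Subtype.ext (Finset.ext fun j => ?_)
  have h : (∑ j ∈ s.1, Finsupp.single j 1 : ℕ+ →₀ ℕ) j =
      (∑ j ∈ t.1, Finsupp.single j 1 : ℕ+ →₀ ℕ) j := by
    rw [show (∑ j ∈ s.1, Finsupp.single j 1 : ℕ+ →₀ ℕ) = d from hs,
      show (∑ j ∈ t.1, Finsupp.single j 1 : ℕ+ →₀ ℕ) = d from ht]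
  simp only [Finsupp.finsetSum_apply, Finsupp.single_apply, Finset.sum_ite_eq'] at h
  by_cases h1 : j ∈ s.1 <;> by_cases h2 : j ∈ t.1 <;> simp_all

/-! Two kinds of graph occur. If `G` has a stable triple, forbidding claw and co-paw forces
adjacency to be transitive (`adj_trans_of_stable_triple`). Then `G` is a disjoint union of cliques
and its symmetric function is a product of terms `n! e_n` (`ePositive_of_adj_trans`).

If `G` has no stable triple, every color class has at most two vertices. Let `E` be `removePair G`
and let `ℓ` be `uniqueSinkCount G`. With `n` the number of vertices, `chromaticSymm_eq_sum` gives
`X_G = ∑ i, (E^i ℓ)(V) e_{n-i} e_i`. To see this, compare coefficients at a monomial with `p`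
squared and `q` simple variables. Choosing the classes of size two and then coloring the other `q`
vertices with distinct colors counts `E^p` of `|T|!`, while `e_{n-i} e_i` contributes `q.choose (i -
p)`. The two agree by `|S|! = ∑ s, |S|.choose s * (E^s ℓ)(S)` (`factorial_card_eq_sum`), a formal
consequence of the recursion for acyclic orientations by sets of sinks.

Positivity thus reduces to `ℓ ≥ 0`. This is proved from the recursion itself, without orientations,
using that the non-neighbors of a vertex form a clique (`uniqueSinkCount_nonneg`). -/

/-! ### Formal sums of monomials. -/

theorem coeff_monomialSum {ι : Type*} (f : ι → (ℕ+ →₀ ℕ)) (d : ℕ+ →₀ ℕ) :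
    MvPowerSeries.coeff d (monomialSum f) = (Nat.card {i : ι // f i = d} : ℚ) := rfl

theorem monomialSum_comp_equiv {ι κ : Type*} (e : ι ≃ κ) (f : κ → (ℕ+ →₀ ℕ)) :
    monomialSum (fun i => f (e i)) = monomialSum f := by
  ext d
  rw [coeff_monomialSum, coeff_monomialSum]
  congr 1
  exact Nat.card_congr (e.subtypeEquiv fun _ => Iff.rfl)

/-- If every fibre of `h` has `n` elements, reindexing along `h` multiplies the sum by `n`. -/
theorem monomialSum_comp_of_card_fiber {ι κ : Type*} (h : ι → κ) {n : ℕ} (hpos : 0 < n)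
    (hn : ∀ k, Nat.card {i // h i = k} = n) (f : κ → (ℕ+ →₀ ℕ)) (hf : ∀ d, {k | f k = d}.Finite) :
    monomialSum (fun i => f (h i)) = (n : ℚ) • monomialSum f := by
  ext d
  rw [MvPowerSeries.coeff_smul, coeff_monomialSum, coeff_monomialSum]
  have : Finite {k // f k = d} := hf d
  have : Fintype {k // f k = d} := Fintype.ofFinite _
  -- `Nat.card` is also `0` on infinite types, so positivity of `n` is what makes the fibres finite.
  have hfib : ∀ k, Finite {i // h i = k} := fun k =>
    Nat.finite_of_card_ne_zero (by rw [hn]; exact hpos.ne')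
  let e : {i // f (h i) = d} ≃ Σ k : {k // f k = d}, {i // h i = k.1} :=
    { toFun := fun i => ⟨⟨h i.1, i.2⟩, ⟨i.1, rfl⟩⟩
      invFun := fun x => ⟨x.2.1, by rw [x.2.2]; exact x.1.2⟩
      left_inv := fun _ => rfl
      right_inv := by rintro ⟨⟨_, hk⟩, ⟨i, hi⟩⟩; cases hi; rfl }
  rw [Nat.card_congr e, Nat.card_sigma]
  simp [hn, mul_comm]

/-- The product of two formal sums of monomials. -/
theorem monomialSum_mul {ι κ : Type*} (f : ι → (ℕ+ →₀ ℕ)) (g : κ → (ℕ+ →₀ ℕ))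
    (hf : ∀ d, {i | f i = d}.Finite) (hg : ∀ d, {k | g k = d}.Finite) :
    monomialSum f * monomialSum g = monomialSum fun x : ι × κ => f x.1 + g x.2 := by
  classical
  ext d
  rw [MvPowerSeries.coeff_mul, coeff_monomialSum]
  have hf' : ∀ d, Finite {i // f i = d} := hf
  have hg' : ∀ d, Finite {k // g k = d} := hg
  let e : {x : ι × κ // f x.1 + g x.2 = d} ≃
      Σ p : Finset.HasAntidiagonal.antidiagonal d, {i // f i = p.1.1} × {k // g k = p.1.2} :=
    { toFun := fun x => ⟨⟨(f x.1.1, g x.1.2), Finset.HasAntidiagonal.mem_antidiagonal.2 x.2⟩, ⟨x.1.1, rfl⟩,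
        ⟨x.1.2, rfl⟩⟩
      invFun := fun y => ⟨(y.2.1.1, y.2.2.1), by
        rw [y.2.1.2, y.2.2.2]; exact Finset.HasAntidiagonal.mem_antidiagonal.1 y.1.2⟩
      left_inv := fun _ => rfl
      right_inv := by rintro ⟨⟨⟨a, b⟩, h⟩, ⟨i, hi⟩, ⟨k, hk⟩⟩; cases hi; cases hk; rfl }
  rw [Nat.card_congr e, Nat.card_sigma, Nat.cast_sum,
    ← Finset.sum_coe_sort (Finset.HasAntidiagonal.antidiagonal d)]
  refine Finset.sum_congr rfl fun p _ => ?_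
  rw [Nat.card_prod, Nat.cast_mul, coeff_monomialSum, coeff_monomialSum]

/-- Parts of a partition are positive, so a factor `e_0`, as in the term `e_n e_0`, has to be
absorbed as `1`. -/
theorem elemSymm_zero : elemSymm 0 = 1 := by
  classical
  ext d
  rw [elemSymm, coeff_monomialSum, MvPowerSeries.coeff_one]
  split_ifs with h
  · have : Unique {s : {s : Finset ℕ+ // s.card = 0} //
        (∑ j ∈ s.1, Finsupp.single j 1 : ℕ+ →₀ ℕ) = d} :=
      { default := ⟨⟨∅, rfl⟩, by simp [h]⟩
        uniq := by
          rintro ⟨⟨s, hs⟩, _⟩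
          obtain rfl := Finset.card_eq_zero.1 hs
          rfl }
    simp
  · have : IsEmpty {s : {s : Finset ℕ+ // s.card = 0} //
        (∑ j ∈ s.1, Finsupp.single j 1 : ℕ+ →₀ ℕ) = d} := by
      refine ⟨?_⟩
      rintro ⟨⟨s, hs⟩, h'⟩
      obtain rfl := Finset.card_eq_zero.1 hs
      exact h (by simpa using h'.symm)
    simp

/-! ### Closure properties of `e`-positivity. -/

namespace EPositive

theorem zero : EPositive 0 := ⟨0, fun _ => le_rfl, by simp⟩

theorem add {f g : MvPowerSeries ℕ+ ℚ} (hf : EPositive f) (hg : EPositive g) :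
    EPositive (f + g) := by
  obtain ⟨c, hc, rfl⟩ := hf
  obtain ⟨c', hc', rfl⟩ := hg
  refine ⟨c + c', fun p => add_nonneg (hc p) (hc' p), ?_⟩
  rw [Finsupp.sum_add_index' (by simp) (fun _ _ _ => add_smul _ _ _)]

theorem smul {f : MvPowerSeries ℕ+ ℚ} (hf : EPositive f) {a : ℚ} (ha : 0 ≤ a) :
    EPositive (a • f) := by
  obtain ⟨c, hc, rfl⟩ := hf
  refine ⟨a • c, fun p => mul_nonneg ha (hc p), ?_⟩
  rw [Finsupp.sum_smul_index (by simp), Finsupp.smul_sum]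
  simp only [mul_smul]

theorem sum {ι : Type*} (s : Finset ι) {f : ι → MvPowerSeries ℕ+ ℚ}
    (hf : ∀ i ∈ s, EPositive (f i)) : EPositive (∑ i ∈ s, f i) :=
  Finset.sum_induction f EPositive (fun _ _ => add) zero hf

theorem elemSymmPart {n : ℕ} (p : n.Partition) : EPositive (elemSymmPart p) := by
  classical
  refine ⟨Finsupp.single ⟨n, p⟩ 1, fun q => ?_, by simp⟩
  rw [Finsupp.single_apply]
  split_ifs <;> simp

theorem multiset_prod (s : Multiset ℕ) (hs : ∀ i ∈ s, 0 < i) :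
    EPositive (s.map elemSymm).prod :=
  elemSymmPart (n := s.sum) ⟨s, fun {i} hi => hs i hi, rfl⟩

theorem one : EPositive 1 := by
  simpa using multiset_prod 0 (by simp)

theorem elemSymm (k : ℕ) : EPositive (elemSymm k) := by
  rcases Nat.eq_zero_or_pos k with rfl | hk
  · rw [elemSymm_zero]
    exact one
  · simpa using multiset_prod {k} (by simpa using hk)

/-- Concatenating the parts of two partitions multiplies their `e`-monomials. -/
theorem mul {f g : MvPowerSeries ℕ+ ℚ} (hf : EPositive f) (hg : EPositive g) :
    EPositive (f * g) := by
  obtain ⟨c, hc, rfl⟩ := hf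
  obtain ⟨c', hc', rfl⟩ := hg
  rw [Finsupp.sum, Finsupp.sum, Finset.sum_mul_sum]
  refine sum _ fun p _ => sum _ fun q _ => ?_
  rw [smul_mul_smul_comm]
  refine smul ?_ (mul_nonneg (hc p) (hc' q))
  have h := multiset_prod (p.2.parts + q.2.parts) fun i hi => by
    rcases Multiset.mem_add.1 hi with h | h
    · exact p.2.parts_pos h
    · exact q.2.parts_pos h
  rwa [Multiset.map_add, Multiset.prod_add] at h

end EPositive

/-! ### Disjoint unions of cliques. -/

/-- The colorings of a graph without edges between `A` and its complement. -/
def coloringEquivOfNoAdj {V α : Type*} (G : SimpleGraph V) (A : Set V) [DecidablePred (· ∈ A)]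
    (hA : ∀ a ∈ A, ∀ b ∉ A, ¬ G.Adj a b) :
    G.Coloring α ≃ (G.induce A).Coloring α × (G.induce (Aᶜ : Set V)).Coloring α where
  toFun κ := (SimpleGraph.Coloring.mk (fun v => κ v) fun {_ _} h => κ.valid h,
    SimpleGraph.Coloring.mk (fun v => κ v) fun {_ _} h => κ.valid h)
  invFun κ := SimpleGraph.Coloring.mk
    (fun v => if h : v ∈ A then κ.1 ⟨v, h⟩ else κ.2 ⟨v, h⟩) <| by
      intro v w hvw
      by_cases hv : v ∈ A <;> by_cases hw : w ∈ A
      · simpa [hv, hw] using κ.1.valid (v := ⟨v, hv⟩) (w := ⟨w, hw⟩) hvw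
      · exact absurd hvw (hA v hv w hw)
      · exact absurd hvw.symm (hA w hw v hv)
      · simpa [hv, hw] using κ.2.valid (v := ⟨v, hv⟩) (w := ⟨w, hw⟩) hvw
  left_inv κ := by
    ext v
    simp [SimpleGraph.Coloring.mk]
  right_inv κ := by
    refine Prod.ext ?_ ?_ <;> ext ⟨v, hv⟩
    · simp [SimpleGraph.Coloring.mk]
    · have hv' : v ∉ A := hv
      simp [SimpleGraph.Coloring.mk, hv']

theorem chromaticSymm_eq_mul_of_noAdj {V : Type*} [Fintype V] (G : SimpleGraph V) (A : Set V)
    [Fintype A] [Fintype (Aᶜ : Set V)] (hA : ∀ a ∈ A, ∀ b ∉ A, ¬ G.Adj a b) :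
    chromaticSymm G = chromaticSymm (G.induce A) * chromaticSymm (G.induce (Aᶜ : Set V)) := by
  classical
  unfold chromaticSymm
  rw [monomialSum_mul _ _ (finite_colorExponent _) (finite_colorExponent _),
    ← monomialSum_comp_equiv (coloringEquivOfNoAdj G A hA)]
  congr 1
  funext κ
  unfold colorExponent
  rw [← Equiv.sum_comp (Equiv.Set.sumCompl A), Fintype.sum_sum_type]
  rfl

/-- The chromatic symmetric function of a complete graph. -/
theorem chromaticSymm_of_complete {V : Type*} [Fintype V] (G : SimpleGraph V)
    (hG : ∀ v w, v ≠ w → G.Adj v w) :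
    chromaticSymm G =
      ((Fintype.card V).factorial : ℚ) • elemSymm (Fintype.card V) := by
  classical
  have hinj : ∀ κ : G.Coloring ℕ+, Function.Injective κ := fun κ v w h => by
    by_contra hne
    exact κ.valid (hG v w hne) h
  let h : G.Coloring ℕ+ → {s : Finset ℕ+ // s.card = Fintype.card V} := fun κ =>
    ⟨Finset.univ.image κ, Finset.card_image_of_injective _ (hinj κ)⟩
  rw [elemSymm, ← monomialSum_comp_of_card_fiber h (Nat.factorial_pos _) _ _ (finite_elemSymm _)]
  · unfold chromaticSymm
    congr 1
    funext κ
    simp only [h, colorExponent]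
    rw [Finset.sum_image fun v _ w _ hvw => hinj κ hvw]
  · rintro ⟨s, hs⟩
    -- Colorings of a clique are injective, so those with color set `s` are the bijections onto `s`.
    let e : {κ // h κ = ⟨s, hs⟩} ≃ (V ≃ s) :=
      { toFun := fun κ => Equiv.ofBijective
          (fun v => ⟨κ.1 v, by
            have : Finset.univ.image κ.1 = s := congrArg Subtype.val κ.2
            exact (Finset.ext_iff.1 this _).1 (Finset.mem_image_of_mem _ (Finset.mem_univ v))⟩)
          ((Fintype.bijective_iff_injective_and_card _).2
            ⟨fun v w hvw => hinj κ.1 (congrArg Subtype.val hvw), by simp [hs]⟩)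
        invFun := fun e => ⟨SimpleGraph.Coloring.mk (fun v => (e v : ℕ+)) (by
            intro v w hvw heq
            exact hvw.ne (e.injective (Subtype.ext heq))), by
          refine Subtype.ext (Finset.ext fun x => ?_)
          simp only [h, Finset.mem_image, Finset.mem_univ, true_and]
          constructor
          · rintro ⟨v, rfl⟩
            exact (e v).2
          · intro hx
            exact ⟨e.symm ⟨x, hx⟩, by simp [SimpleGraph.Coloring.mk]⟩⟩
        left_inv := fun _ => rfl
        right_inv := fun e => by
          ext v
          rfl }
    have e0 : V ≃ s := Fintype.equivOfCardEq (by simp [hs])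
    rw [Nat.card_congr e, Nat.card_eq_fintype_card, Fintype.card_equiv e0]

/-- A disjoint union of cliques is `e`-positive. -/
theorem ePositive_of_adj_trans {V : Type*} [Fintype V] (G : SimpleGraph V)
    (hG : ∀ x y z, x ≠ z → G.Adj x y → G.Adj y z → G.Adj x z) : EPositive (chromaticSymm G) := by
  classical
  induction hn : Fintype.card V using Nat.strong_induction_on generalizing V with
  | _ n ih =>
  rcases isEmpty_or_nonempty V with hV | ⟨⟨v⟩⟩
  · rw [chromaticSymm_of_complete G fun v => hV.elim v]
    exact (EPositive.elemSymm _).smul (Nat.cast_nonneg _)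
  -- By transitivity the closed neighborhood of `v` is a clique and a union of components; it splits
  -- off.
  let A : Set V := {w | w = v ∨ G.Adj v w}
  have hA : ∀ a ∈ A, ∀ b ∉ A, ¬ G.Adj a b := by
    rintro a (rfl | ha) b hb hab
    · exact hb (Or.inr hab)
    · refine hb (Or.inr (hG _ _ _ ?_ ha hab))
      rintro rfl
      exact hb (Or.inl rfl)
  rw [chromaticSymm_eq_mul_of_noAdj G A hA]
  refine EPositive.mul ?_ ?_
  · rw [chromaticSymm_of_complete]
    · exact (EPositive.elemSymm _).smul (Nat.cast_nonneg _)
    · rintro ⟨x, hx⟩ ⟨y, hy⟩ hne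
      have hxy : x ≠ y := fun h => hne (Subtype.ext h)
      change G.Adj x y
      rcases hx with rfl | hx <;> rcases hy with rfl | hy
      · exact absurd rfl hxy
      · exact hy
      · exact hx.symm
      · exact hG _ _ _ hxy hx.symm hy
  · refine ih _ ?_ (G.induce (Aᶜ : Set V)) ?_ rfl
    · rw [← hn]
      exact Fintype.card_subtype_lt (x := v) fun h => h (Or.inl rfl)
    · intro x y z hxz hxy hyz
      exact hG x.1 y.1 z.1 (fun h => hxz (Subtype.ext h)) hxy hyz

/-! ### Removal operators and the algebra of sink counts. -/

section Operators

variable {V : Type*} [DecidableEq V]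

open Classical in
/-- The stable sets of `G` of size `k` inside `S`. -/
noncomputable def stableSubsets (G : SimpleGraph V) (k : ℕ) (S : Finset V) : Finset (Finset V) :=
  (S.powersetCard k).filter fun F => G.IsIndepSet F

theorem mem_stableSubsets {G : SimpleGraph V} {k : ℕ} {S F : Finset V} :
    F ∈ stableSubsets G k S ↔ F ⊆ S ∧ F.card = k ∧ G.IsIndepSet F := by
  simp [stableSubsets, Finset.mem_powersetCard, and_assoc]

/-- Sum of a function over all ways of removing a stable pair. -/
noncomputable def removePair (G : SimpleGraph V) : Module.End ℤ (Finset V → ℤ) where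
  toFun f S := ∑ F ∈ stableSubsets G 2 S, f (S \ F)
  map_add' f g := by ext S; simp [Finset.sum_add_distrib]
  map_smul' a f := by ext S; simp [Finset.mul_sum]

/-- Sum of a function over all ways of removing a vertex. -/
def removeVertex (V : Type*) [DecidableEq V] : Module.End ℤ (Finset V → ℤ) where
  toFun f S := ∑ v ∈ S, f (S.erase v)
  map_add' f g := by ext S; simp [Finset.sum_add_distrib]
  map_smul' a f := by ext S; simp [Finset.mul_sum]

theorem removePair_apply (G : SimpleGraph V) (f : Finset V → ℤ) (S : Finset V) :
    removePair G f S = ∑ F ∈ stableSubsets G 2 S, f (S \ F) := rfl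

theorem removeVertex_apply (f : Finset V → ℤ) (S : Finset V) :
    removeVertex V f S = ∑ v ∈ S, f (S.erase v) := rfl

/-- Both composites sum over a vertex and a stable pair that are disjoint, in either order of
removal. -/
theorem removeVertex_commute_removePair (G : SimpleGraph V) :
    Commute (removeVertex V) (removePair G) := by
  refine LinearMap.ext fun f => funext fun S => ?_
  simp only [Module.End.mul_apply, removePair_apply, removeVertex_apply]
  rw [Finset.sum_comm' (s' := fun F => S \ F) (t' := stableSubsets G 2 S)]
  · refine Finset.sum_congr rfl fun F _ => Finset.sum_congr rfl fun v _ => ?_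
    congr 1
    ext x
    simp only [Finset.mem_sdiff, Finset.mem_erase]
    tauto
  · intro v F
    simp only [mem_stableSubsets, Finset.mem_sdiff, Finset.subset_erase]
    tauto

theorem card_sdiff_of_mem_stableSubsets {G : SimpleGraph V} {k : ℕ} {S F : Finset V}
    (h : F ∈ stableSubsets G k S) : (S \ F).card + k = S.card := by
  obtain ⟨h1, h2, -⟩ := mem_stableSubsets.1 h
  rw [← h2, Finset.card_sdiff_add_card_eq_card h1]

/-- `removePair G ^ j` only looks at sets with `2 * j` fewer elements. -/
theorem removePair_pow_congr (G : SimpleGraph V) (j : ℕ) {f g : Finset V → ℤ} {S : Finset V}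
    (h : ∀ T : Finset V, T.card + 2 * j = S.card → f T = g T) :
    (removePair G ^ j) f S = (removePair G ^ j) g S := by
  induction j generalizing S with
  | zero => exact h S (by simp)
  | succ j ih =>
    simp only [pow_succ', Module.End.mul_apply, removePair_apply]
    refine Finset.sum_congr rfl fun F hF => ih fun T hT => h T ?_
    have := card_sdiff_of_mem_stableSubsets hF
    omega

theorem removePair_pow_eq_zero (G : SimpleGraph V) {j : ℕ} (f : Finset V → ℤ) {S : Finset V}
    (h : S.card < 2 * j) : (removePair G ^ j) f S = 0 := by
  rw [removePair_pow_congr G j (g := 0) fun T hT => by omega]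
  simp

theorem removePair_pow_nonneg (G : SimpleGraph V) (j : ℕ) {f : Finset V → ℤ} (hf : ∀ S, 0 ≤ f S)
    (S : Finset V) : 0 ≤ (removePair G ^ j) f S := by
  induction j generalizing S with
  | zero => exact hf S
  | succ j ih =>
    simp only [pow_succ', Module.End.mul_apply, removePair_apply]
    exact Finset.sum_nonneg fun F _ => ih _

/-- For graphs without stable triples, this is the number of acyclic orientations of the subgraph
induced on `S`, computed by removing sets of sinks. -/
noncomputable def acyclicCount (G : SimpleGraph V) (S : Finset V) : ℤ :=
  if S = ∅ then 1 else
    ∑ v : S, acyclicCount G (S.erase v) -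
      ∑ F : stableSubsets G 2 S, acyclicCount G (S \ F)
termination_by S.card
decreasing_by
  · exact Finset.card_erase_lt_of_mem v.2
  · have := card_sdiff_of_mem_stableSubsets F.2
    omega

theorem acyclicCount_empty (G : SimpleGraph V) : acyclicCount G ∅ = 1 := by
  rw [acyclicCount, if_pos rfl]

theorem acyclicCount_of_nonempty (G : SimpleGraph V) {S : Finset V} (hS : S.Nonempty) :
    acyclicCount G S =
      removeVertex V (acyclicCount G) S - removePair G (acyclicCount G) S := by
  rw [acyclicCount, if_neg hS.ne_empty, removeVertex_apply, removePair_apply,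
    Finset.sum_coe_sort S fun v => acyclicCount G (S.erase v),
    Finset.sum_coe_sort (stableSubsets G 2 S) fun F => acyclicCount G (S \ F)]

/-- The indicator function of the empty set. -/
def emptyIndicator (V : Type*) [DecidableEq V] : Finset V → ℤ := fun S => if S = ∅ then 1 else 0

theorem removePair_empty (G : SimpleGraph V) (f : Finset V → ℤ) : removePair G f ∅ = 0 := by
  simpa using removePair_pow_eq_zero G (j := 1) f (S := ∅) (by simp)

/-- The recursion, rearranged as an operator identity; the indicator corrects the value at the empty
set, where the recursion does not apply. -/
theorem removeVertex_acyclicCount (G : SimpleGraph V) :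
    removeVertex V (acyclicCount G) =
      acyclicCount G + removePair G (acyclicCount G) - emptyIndicator V := by
  ext S
  rcases S.eq_empty_or_nonempty with rfl | hS
  · simp [removeVertex_apply, removePair_empty, acyclicCount_empty, emptyIndicator]
  · simp only [Pi.sub_apply, Pi.add_apply, acyclicCount_of_nonempty G hS, emptyIndicator,
      if_neg hS.ne_empty]
    ring

/-- For graphs without stable triples, this is the number of acyclic orientations of the subgraph
induced on `S` with exactly one sink, if `S` is nonempty. -/
noncomputable def uniqueSinkCount (G : SimpleGraph V) : Finset V → ℤ :=
  acyclicCount G - removePair G (acyclicCount G)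

/-- Apply `1 - removePair G` to `removeVertex_acyclicCount` and commute the two operators. -/
theorem removeVertex_uniqueSinkCount (G : SimpleGraph V) :
    removeVertex V (uniqueSinkCount G) =
      uniqueSinkCount G + removePair G (uniqueSinkCount G) - emptyIndicator V +
        removePair G (emptyIndicator V) := by
  have h : removeVertex V (removePair G (acyclicCount G)) =
      removePair G (removeVertex V (acyclicCount G)) :=
    LinearMap.congr_fun (removeVertex_commute_removePair G) _
  simp only [uniqueSinkCount, map_sub, h, removeVertex_acyclicCount, map_add]
  ring

/-- Sum over the stable pairs through a given vertex. -/
theorem sum_stablePairs_filter_mem (G : SimpleGraph V) (f : Finset V → ℤ) {T : Finset V} {u : V}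
    (hu : u ∈ T) (p : Finset V → Prop) [DecidablePred p]
    [DecidablePred fun w => ¬ G.Adj u w ∧ p {u, w}] :
    ∑ F ∈ (stableSubsets G 2 T).filter (fun F => u ∈ F ∧ p F), f (T \ F) =
      ∑ w ∈ (T.erase u).filter (fun w => ¬ G.Adj u w ∧ p {u, w}), f ((T.erase u).erase w) := by
  symm
  refine Finset.sum_bij (fun w _ => {u, w}) ?_ ?_ ?_ ?_
  · intro w hw
    simp only [Finset.mem_filter, Finset.mem_erase] at hw
    obtain ⟨⟨hwu, hwT⟩, hadj, hp⟩ := hw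
    simp only [Finset.mem_filter, mem_stableSubsets]
    refine ⟨⟨?_, Finset.card_pair (Ne.symm hwu), ?_⟩, by simp, hp⟩
    · simp [Finset.insert_subset_iff, hu, hwT]
    · rw [Finset.coe_pair]
      intro a ha b hb hab
      simp only [Set.mem_insert_iff, Set.mem_singleton_iff] at ha hb
      rcases ha with rfl | rfl <;> rcases hb with rfl | rfl
      · exact absurd rfl hab
      · exact hadj
      · exact fun h => hadj h.symm
      · exact absurd rfl hab
  · intro w hw w' hw' h
    simp only [Finset.mem_filter, Finset.mem_erase] at hw hw'
    have : w ∈ ({u, w'} : Finset V) := by rw [← h]; simp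
    simpa [hw.1.1] using this
  · intro F hF
    simp only [Finset.mem_filter, mem_stableSubsets] at hF
    obtain ⟨⟨hFT, hF2, hind⟩, huF, hp⟩ := hF
    obtain ⟨a, b, hab, rfl⟩ := Finset.card_eq_two.1 hF2
    have key : ∀ a b : V, a ≠ b → ({a, b} : Finset V) ⊆ T →
        G.IsIndepSet (({a, b} : Finset V) : Set V) → p {a, b} → u = a →
        ∃ w, ∃ _ : w ∈ (T.erase u).filter (fun w => ¬ G.Adj u w ∧ p {u, w}),
          ({u, w} : Finset V) = {a, b} := by
      rintro a b hab hT hi hp rfl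
      refine ⟨b, ?_, rfl⟩
      simp only [Finset.mem_filter, Finset.mem_erase]
      exact ⟨⟨hab.symm, hT (by simp)⟩, hi (by simp) (by simp) hab, hp⟩
    rcases (by simpa using huF : u = a ∨ u = b) with h | h
    · exact key a b hab hFT hind hp h
    · rw [Finset.pair_comm a b] at hFT hind hp ⊢
      exact key b a hab.symm hFT hind hp h
  · intro w hw
    congr 1
    ext x
    simp only [Finset.mem_erase, Finset.mem_sdiff, Finset.mem_insert, Finset.mem_singleton]
    tauto

/-- At most one vertex of a clique is a sink. -/
theorem sum_acyclicCount_erase_le (G : SimpleGraph V)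
    (hG : ∀ a b c, a ≠ b → b ≠ c → a ≠ c → G.Adj a b ∨ G.Adj b c ∨ G.Adj a c)
    (T K : Finset V) (hK : K ⊆ T) (hclique : G.IsClique K) :
    ∑ w ∈ K, acyclicCount G (T.erase w) ≤ acyclicCount G T := by
  classical
  induction hn : T.card using Nat.strong_induction_on generalizing T K with
  | _ n ih =>
  rcases T.eq_empty_or_nonempty with rfl | hT
  · obtain rfl := Finset.subset_empty.1 hK
    simp [acyclicCount_empty]
  obtain ⟨v₀, hv₀⟩ := hT
  -- A stable pair cannot lie inside a clique. Charging each pair to a chosen vertex `φ F` outside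
  -- `K` splits the inequality into one for each `u ∈ T \ K`.
  have hex : ∀ F ∈ stableSubsets G 2 T, ∃ u, u ∈ F ∧ u ∉ K := by
    intro F hF
    obtain ⟨-, hF2, hind⟩ := mem_stableSubsets.1 hF
    by_contra! hcon
    obtain ⟨a, b, hab, rfl⟩ := Finset.card_eq_two.1 hF2
    exact hind (by simp) (by simp) hab (hclique (hcon a (by simp)) (hcon b (by simp)) hab)
  have : Nonempty V := ⟨v₀⟩
  choose! φ hφ hφK using hex
  rw [acyclicCount_of_nonempty G ⟨v₀, hv₀⟩, removeVertex_apply, removePair_apply,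
    ← Finset.sum_sdiff hK, le_sub_iff_add_le, add_comm, add_le_add_iff_right]
  rw [← Finset.sum_fiberwise_of_maps_to (s := stableSubsets G 2 T) (t := T \ K) (g := φ)
    fun F hF => Finset.mem_sdiff.2 ⟨(mem_stableSubsets.1 hF).1 (hφ F hF), hφK F hF⟩]
  refine Finset.sum_le_sum fun u hu => ?_
  have huT : u ∈ T := (Finset.mem_sdiff.1 hu).1
  have h1 : (stableSubsets G 2 T).filter (fun F => φ F = u) =
      (stableSubsets G 2 T).filter (fun F => u ∈ F ∧ φ F = u) := by
    refine Finset.filter_congr fun F hF => ⟨fun h => ⟨h ▸ hφ F hF, h⟩, fun h => h.2⟩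
  rw [h1, sum_stablePairs_filter_mem G (acyclicCount G) huT fun F => φ F = u]
  -- The partners of `u` in the pairs charged to it are non-neighbors of `u`, hence a clique in
  -- `T.erase u`.
  refine ih (T.erase u).card (hn ▸ Finset.card_erase_lt_of_mem huT) _ _ (Finset.filter_subset _ _)
    ?_ rfl
  intro w hw w' hw' hne
  simp only [Finset.coe_filter, Finset.mem_erase, Set.mem_ofPred_eq] at hw hw'
  rcases hG u w w' (Ne.symm hw.1.1) hne (Ne.symm hw'.1.1) with h | h | h
  · exact absurd h hw.2.1
  · exact h
  · exact absurd h hw'.2.1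

/-- By the recursion, `ℓ(S)` is the vertex sum minus twice the pair sum. Counting each pair once
from each end makes this a sum over `v` of `a(S - v) - ∑ w, a(S - v - w)`, where `a` is
`acyclicCount G` and `w` runs over the non-neighbors of `v`. These form a clique, so
`sum_acyclicCount_erase_le` applies. -/
theorem uniqueSinkCount_nonneg (G : SimpleGraph V)
    (hG : ∀ a b c, a ≠ b → b ≠ c → a ≠ c → G.Adj a b ∨ G.Adj b c ∨ G.Adj a c)
    (S : Finset V) : 0 ≤ uniqueSinkCount G S := by
  classical
  rcases S.eq_empty_or_nonempty with rfl | hS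
  · simp [uniqueSinkCount, removePair_empty, acyclicCount_empty]
  have h2 : 2 * removePair G (acyclicCount G) S =
      ∑ v ∈ S, ∑ F ∈ (stableSubsets G 2 S).filter (fun F => v ∈ F ∧ True),
        acyclicCount G (S \ F) := by
    rw [removePair_apply, Finset.mul_sum,
      Finset.sum_comm' (s' := fun F => F) (t' := stableSubsets G 2 S)]
    · refine Finset.sum_congr rfl fun F hF => ?_
      rw [Finset.sum_const, (mem_stableSubsets.1 hF).2.1]
      simp
    · intro v F
      simp only [Finset.mem_filter, mem_stableSubsets, and_true]
      constructor
      · tauto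
      · rintro ⟨h, h'⟩
        exact ⟨h'.1 h, h', h⟩
  have h3 : uniqueSinkCount G S =
      removeVertex V (acyclicCount G) S - 2 * removePair G (acyclicCount G) S := by
    rw [uniqueSinkCount, Pi.sub_apply, acyclicCount_of_nonempty G hS]
    ring
  rw [h3, h2, removeVertex_apply, ← Finset.sum_sub_distrib]
  refine Finset.sum_nonneg fun v hv => sub_nonneg.2 ?_
  rw [sum_stablePairs_filter_mem G (acyclicCount G) hv fun _ => True]
  refine sum_acyclicCount_erase_le G hG _ _ (Finset.filter_subset _ _) ?_
  intro w hw w' hw' hne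
  simp only [Finset.coe_filter, Finset.mem_erase, Set.mem_ofPred_eq] at hw hw'
  rcases hG v w w' (Ne.symm hw.1.1) hne (Ne.symm hw'.1.1) with h | h | h
  · exact absurd h hw.2.1
  · exact h
  · exact absurd h hw'.2.1

/-- Induct by summing over deleted vertices: the left side becomes `(n + 1)!`, and `removeVertex`
acts on `ℓ` as `1 + E` up to indicator terms, so Pascal's rule raises `n` to `n + 1`. Any `R` past
the vanishing point of `E^s` at `S` is allowed, so that one range serves all subsets. -/
theorem factorial_card_eq_sum (G : SimpleGraph V) (R : ℕ) (S : Finset V) (hR : S.card < 2 * R) :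
    (S.card.factorial : ℤ) =
      ∑ s ∈ Finset.range R, (S.card.choose s : ℤ) * (removePair G ^ s) (uniqueSinkCount G) S := by
  induction hn : S.card generalizing S with
  | zero =>
    obtain rfl := Finset.card_eq_zero.1 hn
    obtain ⟨R, rfl⟩ := Nat.exists_eq_succ_of_ne_zero (by omega : R ≠ 0)
    rw [Finset.sum_range_succ']
    simp [uniqueSinkCount, removePair_empty, acyclicCount_empty]
  | succ n ih =>
    obtain ⟨R, rfl⟩ := Nat.exists_eq_succ_of_ne_zero (by omega : R ≠ 0)
    set E := removePair G with hE
    set ℓ := uniqueSinkCount G with hℓ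
    have h1 : ((n + 1).factorial : ℤ) = ∑ v ∈ S, ∑ s ∈ Finset.range (R + 1),
        (n.choose s : ℤ) * (E ^ s) ℓ (S.erase v) := by
      have : ∀ v ∈ S, ∑ s ∈ Finset.range (R + 1),
          (n.choose s : ℤ) * (E ^ s) ℓ (S.erase v) = n.factorial := by
        intro v hv
        have hc : (S.erase v).card = n := by rw [Finset.card_erase_of_mem hv, hn]; rfl
        rw [ih (S.erase v) (by omega) hc]
      rw [Finset.sum_congr rfl this, Finset.sum_const, hn, Nat.factorial_succ]
      simp
    have h2 : ∀ s, ∑ v ∈ S, (E ^ s) ℓ (S.erase v) = (E ^ s) ℓ S + (E ^ (s + 1)) ℓ S -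
        (E ^ s) (emptyIndicator V) S + (E ^ (s + 1)) (emptyIndicator V) S := by
      intro s
      have h3 : removeVertex V ((E ^ s) ℓ) = (E ^ s) (removeVertex V ℓ) :=
        LinearMap.congr_fun ((removeVertex_commute_removePair G).pow_right s) _
      rw [← removeVertex_apply, h3, removeVertex_uniqueSinkCount]
      simp only [map_add, map_sub, Pi.add_apply, Pi.sub_apply, pow_succ, Module.End.mul_apply]
      rfl
    have hδ : ∀ s, S.card ≠ 2 * s → (E ^ s) (emptyIndicator V) S = 0 := by
      intro s hs
      rw [removePair_pow_congr G s (g := 0)]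
      · simp
      · intro T hT
        have : T ≠ ∅ := by rintro rfl; simp at hT; omega
        simp [emptyIndicator, this]
    have hpascal : ∀ g : Finset V → ℤ, (E ^ (R + 1)) g S = 0 →
        ∑ s ∈ Finset.range (R + 1), ((n + 1).choose s : ℤ) * (E ^ s) g S =
        ∑ s ∈ Finset.range (R + 1), (n.choose s : ℤ) * (E ^ s) g S +
          ∑ s ∈ Finset.range (R + 1), (n.choose s : ℤ) * (E ^ (s + 1)) g S := by
      intro g hg
      rw [Finset.sum_range_succ' (fun s => ((n + 1).choose s : ℤ) * (E ^ s) g S),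
        Finset.sum_range_succ' (fun s => (n.choose s : ℤ) * (E ^ s) g S),
        Finset.sum_range_succ (fun s => (n.choose s : ℤ) * (E ^ (s + 1)) g S), hg]
      simp only [Nat.choose_succ_succ, Nat.cast_add, add_mul, Finset.sum_add_distrib]
      simp
      ring
    -- The indicator terms cancel: they survive only if `n + 1 = 2 * (s + 1)`, and then the two
    -- coefficients are the equal middle binomials of `2 * s + 1`.
    have h4 : ∑ s ∈ Finset.range (R + 1), (n.choose s : ℤ) * (E ^ s) (emptyIndicator V) S =
        ∑ s ∈ Finset.range (R + 1), (n.choose s : ℤ) * (E ^ (s + 1)) (emptyIndicator V) S := by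
      rw [Finset.sum_range_succ' (fun s => (n.choose s : ℤ) * (E ^ s) (emptyIndicator V) S),
        Finset.sum_range_succ (fun s => (n.choose s : ℤ) * (E ^ (s + 1)) (emptyIndicator V) S),
        hδ 0 (by omega), hδ (R + 1) (by omega)]
      congr 1
      refine Finset.sum_congr rfl fun s _ => ?_
      by_cases hs : S.card = 2 * (s + 1)
      · have : n = 2 * s + 1 := by omega
        rw [this, Nat.choose_symm_half]
      · rw [hδ _ hs]
        simp
    rw [hpascal ℓ (removePair_pow_eq_zero G ℓ (by omega)), h1, Finset.sum_comm]
    simp only [← Finset.mul_sum, h2, mul_add, mul_sub, Finset.sum_add_distrib,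
      Finset.sum_sub_distrib]
    linarith

end Operators

/-! ### Coefficients of `X_G` and of products of two elementary functions. -/

section Counting

variable {V : Type*}

/-- `κ` is a proper coloring on `S` using each color `x` exactly `d x` times, and `κ` is constant
outside `S`. -/
def IsColoringOn (G : SimpleGraph V) (S : Finset V) (d : ℕ+ →₀ ℕ) (κ : V → ℕ+) : Prop :=
  (∀ v ∉ S, κ v = 1) ∧ (∀ u ∈ S, ∀ v ∈ S, G.Adj u v → κ u ≠ κ v) ∧
    ∀ x, (S.filter fun v => κ v = x).card = d x

/-- The number of proper colorings on `S` using each color `x` exactly `d x` times. -/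
noncomputable def colorCount (G : SimpleGraph V) (S : Finset V) (d : ℕ+ →₀ ℕ) : ℕ :=
  Nat.card {κ : V → ℕ+ // IsColoringOn G S d κ}

theorem IsColoringOn.ne_of_erase {G : SimpleGraph V} {S : Finset V} {d : ℕ+ →₀ ℕ} {c : ℕ+}
    {κ : V → ℕ+} (h : IsColoringOn G S (d.erase c) κ) {v : V} (hv : v ∈ S) : κ v ≠ c := by
  intro hc
  have h0 := h.2.2 c
  rw [Finsupp.erase_same, Finset.card_eq_zero] at h0
  have : v ∈ S.filter fun v => κ v = c := Finset.mem_filter.2 ⟨hv, hc⟩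
  simp [h0] at this

theorem colorCount_empty_zero (G : SimpleGraph V) : colorCount G ∅ 0 = 1 := by
  have : Unique {κ : V → ℕ+ // IsColoringOn G ∅ 0 κ} :=
    { default := ⟨fun _ => 1, by simp [IsColoringOn]⟩
      uniq := fun κ => Subtype.ext (funext fun v => κ.2.1 v (by simp)) }
  exact Nat.card_unique

theorem colorExponent_apply [Fintype V] (κ : V → ℕ+) (x : ℕ+) :
    colorExponent κ x = (Finset.univ.filter fun v => κ v = x).card := by
  simp [colorExponent, Finsupp.finsetSum_apply, Finsupp.single_apply]

theorem coeff_chromaticSymm [Fintype V] (G : SimpleGraph V) (d : ℕ+ →₀ ℕ) :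
    MvPowerSeries.coeff d (chromaticSymm G) = (colorCount G Finset.univ d : ℚ) := by
  rw [chromaticSymm, coeff_monomialSum, colorCount]
  congr 1
  refine Nat.card_congr
    { toFun := fun κ => ⟨κ.1, by simp, fun u _ v _ h => κ.1.valid h, fun x => by
        exact (colorExponent_apply κ.1 x).symm.trans (DFunLike.congr_fun κ.2 x)⟩
      invFun := fun κ => ⟨SimpleGraph.Coloring.mk κ.1 fun {u v} h =>
        κ.2.2.1 u (Finset.mem_univ u) v (Finset.mem_univ v) h, by
          ext x
          rw [← κ.2.2.2 x, colorExponent_apply]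
          rfl⟩
      left_inv := fun _ => rfl
      right_inv := fun _ => rfl }

theorem colorCount_univ_eq_zero [Fintype V] (G : SimpleGraph V)
    (hG : ∀ a b c, a ≠ b → b ≠ c → a ≠ c → G.Adj a b ∨ G.Adj b c ∨ G.Adj a c)
    (d : ℕ+ →₀ ℕ) (hd : ¬ ((∀ x, d x ≤ 2) ∧ d.degree = Fintype.card V)) :
    colorCount G Finset.univ d = 0 := by
  rw [colorCount, Nat.card_eq_zero]
  left
  refine ⟨?_⟩
  rintro ⟨κ, -, h2, h3⟩
  refine hd ⟨fun x => ?_, ?_⟩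
  · by_contra! hx
    rw [← h3 x, Finset.two_lt_card] at hx
    obtain ⟨a, ha, b, hb, c, hc, hab, hac, hbc⟩ := hx
    simp only [Finset.mem_filter, Finset.mem_univ, true_and] at ha hb hc
    have hne := fun u v => h2 u (Finset.mem_univ u) v (Finset.mem_univ v)
    rcases hG a b c hab hbc hac with h | h | h
    · exact hne _ _ h (ha.trans hb.symm)
    · exact hne _ _ h (hb.trans hc.symm)
    · exact hne _ _ h (ha.trans hc.symm)
  · have : d = colorExponent κ := by
      ext x
      rw [colorExponent_apply, h3]
    rw [this, colorExponent, map_sum]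
    simp

variable [DecidableEq V]

theorem finite_isColoringOn [Fintype V] (G : SimpleGraph V) (S : Finset V) (d : ℕ+ →₀ ℕ) :
    Finite {κ : V → ℕ+ // IsColoringOn G S d κ} := by
  have h : (Set.pi Set.univ fun _ : V => ((insert 1 d.support : Finset ℕ+) : Set ℕ+)).Finite :=
    Set.Finite.pi fun _ => Finset.finite_toSet _
  refine Set.Finite.subset h ?_
  rintro κ ⟨h1, -, h3⟩ v -
  simp only [Finset.mem_coe, Finset.mem_insert, Finsupp.mem_support_iff]
  by_cases hv : v ∈ S
  · right
    rw [← h3]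
    exact Finset.card_ne_zero_of_mem (Finset.mem_filter.2 ⟨hv, rfl⟩)
  · exact Or.inl (h1 v hv)

theorem IsColoringOn.extend {G : SimpleGraph V} {S F : Finset V} {d : ℕ+ →₀ ℕ} {c : ℕ+}
    (hF : F ∈ stableSubsets G (d c) S) {κ : V → ℕ+} (h : IsColoringOn G (S \ F) (d.erase c) κ) :
    IsColoringOn G S d fun v => if v ∈ F then c else κ v := by
  obtain ⟨hFS, hFc, hind⟩ := mem_stableSubsets.1 hF
  refine ⟨fun v hv => ?_, fun u hu v hv huv => ?_, fun x => ?_⟩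
  · exact (if_neg fun hvF => hv (hFS hvF)).trans
      (h.1 v fun hv' => hv (Finset.mem_sdiff.1 hv').1)
  · by_cases huF : u ∈ F <;> by_cases hvF : v ∈ F
    · exact absurd huv (hind huF hvF huv.ne)
    · simpa [huF, hvF] using (h.ne_of_erase (Finset.mem_sdiff.2 ⟨hv, hvF⟩)).symm
    · simpa [huF, hvF] using h.ne_of_erase (Finset.mem_sdiff.2 ⟨hu, huF⟩)
    · simpa [huF, hvF] using
        h.2.1 u (Finset.mem_sdiff.2 ⟨hu, huF⟩) v (Finset.mem_sdiff.2 ⟨hv, hvF⟩) huv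
  · by_cases hx : x = c
    · subst hx
      rw [← hFc]
      congr 1
      ext v
      simp only [Finset.mem_filter]
      constructor
      · rintro ⟨hv, hvx⟩
        by_contra hvF
        rw [if_neg hvF] at hvx
        exact h.ne_of_erase (Finset.mem_sdiff.2 ⟨hv, hvF⟩) hvx
      · intro hv
        exact ⟨hFS hv, if_pos hv⟩
    · rw [← Finsupp.erase_ne (f := d) hx, ← h.2.2 x]
      congr 1
      ext v
      simp only [Finset.mem_filter, Finset.mem_sdiff]
      by_cases hvF : v ∈ F
      · simp [hvF, Ne.symm hx]
      · simp [hvF]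

/-- Removing the color class of `c`. -/
theorem colorCount_eq_sum [Fintype V] (G : SimpleGraph V) (S : Finset V) (d : ℕ+ →₀ ℕ) (c : ℕ+) :
    colorCount G S d =
      ∑ F ∈ stableSubsets G (d c) S, colorCount G (S \ F) (d.erase c) := by
  let e : (Σ F : stableSubsets G (d c) S, {κ : V → ℕ+ // IsColoringOn G (S \ F) (d.erase c) κ}) →
      {κ : V → ℕ+ // IsColoringOn G S d κ} :=
    fun x => ⟨_, x.2.2.extend x.1.2⟩
  have hclass : ∀ x, (x.1 : Finset V) = S.filter fun v => (e x).1 v = c := by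
    rintro ⟨⟨F, hF⟩, κ, hκ⟩
    ext v
    simp only [e, Finset.mem_filter]
    constructor
    · intro hv
      exact ⟨(mem_stableSubsets.1 hF).1 hv, if_pos hv⟩
    · rintro ⟨hv, hvx⟩
      by_contra hvF
      rw [if_neg hvF] at hvx
      exact hκ.ne_of_erase (Finset.mem_sdiff.2 ⟨hv, hvF⟩) hvx
  have he : Function.Bijective e := by
    constructor
    · intro x y hxy
      have hF : x.1 = y.1 := Subtype.ext (by rw [hclass x, hclass y, hxy])
      obtain ⟨F, κ, hκ⟩ := x
      obtain ⟨F', κ', hκ'⟩ := y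
      obtain rfl : F = F' := hF
      congr 2
      funext v
      have hv := congrFun (congrArg Subtype.val hxy) v
      by_cases hvF : v ∈ F.1
      · have : v ∉ S \ F.1 := fun h => (Finset.mem_sdiff.1 h).2 hvF
        -- Extension overwrites the values on `F`; nothing is lost, since both maps take the default
        -- value `1` there.
        rw [hκ.1 v this, hκ'.1 v this]
      · simpa [e, hvF] using hv
    · rintro ⟨κ, h1, h2, h3⟩
      let F := S.filter fun v => κ v = c
      have hF : F ∈ stableSubsets G (d c) S := by
        refine mem_stableSubsets.2 ⟨Finset.filter_subset _ _, h3 c, fun u hu v hv _ huv => ?_⟩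
        have hu' := Finset.mem_filter.1 (Finset.mem_coe.1 hu)
        have hv' := Finset.mem_filter.1 (Finset.mem_coe.1 hv)
        exact h2 u hu'.1 v hv'.1 huv (hu'.2.trans hv'.2.symm)
      refine ⟨⟨⟨F, hF⟩, fun v => if v ∈ F then 1 else κ v, fun v hv => ?_, fun u hu v hv huv => ?_,
        fun x => ?_⟩, Subtype.ext (funext fun v => ?_)⟩
      · by_cases hvF : v ∈ F
        · exact if_pos hvF
        · exact (if_neg hvF).trans (h1 v fun hvS => hv (Finset.mem_sdiff.2 ⟨hvS, hvF⟩))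
      · obtain ⟨huS, huF⟩ := Finset.mem_sdiff.1 hu
        obtain ⟨hvS, hvF⟩ := Finset.mem_sdiff.1 hv
        change (if u ∈ F then 1 else κ u) ≠ if v ∈ F then 1 else κ v
        rw [if_neg huF, if_neg hvF]
        exact h2 u huS v hvS huv
      · by_cases hx : x = c
        · subst hx
          rw [Finsupp.erase_same, Finset.card_eq_zero, Finset.filter_eq_empty_iff]
          intro v hv
          obtain ⟨hvS, hvF⟩ := Finset.mem_sdiff.1 hv
          change ¬ (if v ∈ F then 1 else κ v) = x
          rw [if_neg hvF]
          exact fun h => hvF (Finset.mem_filter.2 ⟨hvS, h⟩)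
        · refine Eq.trans ?_ ((h3 x).trans (Finsupp.erase_ne hx).symm)
          congr 1
          ext v
          simp only [Finset.mem_filter, Finset.mem_sdiff]
          by_cases hvF : v ∈ F
          · have : κ v = c := (Finset.mem_filter.1 hvF).2
            simp [hvF, this, Ne.symm hx]
          · simp [hvF]
      · by_cases hvF : v ∈ F
        · simpa [e, hvF] using (Finset.mem_filter.1 hvF).2.symm
        · simp [e, hvF]
  have := fun F : stableSubsets G (d c) S => finite_isColoringOn G (S \ F) (d.erase c)
  rw [colorCount, ← Nat.card_eq_of_bijective e he, Nat.card_sigma]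
  exact Finset.sum_coe_sort (stableSubsets G (d c) S) fun F => colorCount G (S \ F) (d.erase c)

theorem degree_eq_add_degree_erase (d : ℕ+ →₀ ℕ) (c : ℕ+) :
    d.degree = d c + (d.erase c).degree := by
  conv_lhs => rw [← Finsupp.single_add_erase c d]
  rw [map_add, Finsupp.degree_single]

theorem card_stableSubsets_one (G : SimpleGraph V) (S : Finset V) :
    (stableSubsets G 1 S).card = S.card := by
  classical
  rw [← Nat.choose_one_right S.card, ← Finset.card_powersetCard]
  congr 1
  refine Finset.filter_true_of_mem fun F hF => ?_
  obtain ⟨v, rfl⟩ := Finset.card_eq_one.1 (Finset.mem_powersetCard.1 hF).2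
  simp

theorem colorCount_of_le_one [Fintype V] (G : SimpleGraph V) (S : Finset V) (d : ℕ+ →₀ ℕ)
    (hd : ∀ x, d x ≤ 1) (hS : S.card = d.degree) : colorCount G S d = S.card.factorial := by
  induction hn : S.card generalizing S d with
  | zero =>
    obtain rfl := Finset.card_eq_zero.1 hn
    obtain rfl : d = 0 := (Finsupp.degree_eq_zero_iff d).1 (by omega)
    exact colorCount_empty_zero G
  | succ n ih =>
    obtain ⟨c, hc⟩ : ∃ c, d c ≠ 0 := by
      by_contra! h
      have : d = 0 := Finsupp.ext h
      rw [this, map_zero] at hS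
      omega
    have hc1 : d c = 1 := le_antisymm (hd c) (Nat.one_le_iff_ne_zero.2 hc)
    have hdeg := degree_eq_add_degree_erase d c
    rw [colorCount_eq_sum G S d c, hc1, Finset.sum_congr rfl (g := fun _ => n.factorial),
      Finset.sum_const, card_stableSubsets_one, hn, Nat.factorial_succ, smul_eq_mul]
    intro F hF
    have := card_sdiff_of_mem_stableSubsets hF
    refine ih _ _ (fun x => ?_) (by omega) (by omega)
    rw [Finsupp.erase_apply]
    split_ifs
    · exact Nat.zero_le _
    · exact hd x

/-- Each color in `P` removes a stable pair; the remaining vertices then receive distinct colors, in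
factorially many ways. -/
theorem colorCount_eq_removePair_pow [Fintype V] (G : SimpleGraph V) (P : Finset ℕ+)
    (S : Finset V) (d : ℕ+ →₀ ℕ) (hP : ∀ x ∈ P, d x = 2) (hP' : ∀ x ∉ P, d x ≤ 1)
    (hS : S.card = d.degree) :
    (colorCount G S d : ℤ) = (removePair G ^ P.card) (fun T => (T.card.factorial : ℤ)) S := by
  induction P using Finset.induction_on generalizing S d with
  | empty =>
    rw [colorCount_of_le_one G S d (fun x => hP' x (by simp)) hS]
    simp
  | insert c P hc ih =>
    have hc2 : d c = 2 := hP c (by simp)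
    have hdeg := degree_eq_add_degree_erase d c
    rw [colorCount_eq_sum G S d c, hc2, Finset.card_insert_of_notMem hc, pow_succ',
      Module.End.mul_apply, removePair_apply, Nat.cast_sum]
    refine Finset.sum_congr rfl fun F hF => ih _ _ (fun x hx => ?_) (fun x hx => ?_) ?_
    · rw [Finsupp.erase_ne (by rintro rfl; exact hc hx)]
      exact hP x (by simp [hx])
    · rw [Finsupp.erase_apply]
      split_ifs with h
      · exact Nat.zero_le _
      · exact hP' x (by simp [h, hx])
    · have := card_sdiff_of_mem_stableSubsets hF
      omega

theorem sum_single_one_apply (s : Finset ℕ+) (x : ℕ+) :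
    (∑ j ∈ s, Finsupp.single j 1 : ℕ+ →₀ ℕ) x = if x ∈ s then 1 else 0 := by
  simp [Finsupp.finsetSum_apply, Finsupp.single_apply]

theorem coeff_elemSymm_mul_elemSymm (a b : ℕ) (d : ℕ+ →₀ ℕ) :
    MvPowerSeries.coeff d (elemSymm a * elemSymm b) =
      (Nat.card {x : {s : Finset ℕ+ // s.card = a} × {t : Finset ℕ+ // t.card = b} //
        ∀ j, (if j ∈ x.1.1 then 1 else 0) + (if j ∈ x.2.1 then 1 else 0) = d j} : ℚ) := by
  rw [elemSymm, elemSymm, monomialSum_mul _ _ (finite_elemSymm a) (finite_elemSymm b),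
    coeff_monomialSum]
  congr 1
  refine Nat.card_congr (Equiv.subtypeEquivRight fun x => ?_)
  simp only [Finsupp.ext_iff, Finsupp.add_apply, sum_single_one_apply]

theorem coeff_elemSymm_mul_elemSymm_eq_zero (a b : ℕ) (d : ℕ+ →₀ ℕ)
    (hd : ¬ ((∀ x, d x ≤ 2) ∧ d.degree = a + b)) :
    MvPowerSeries.coeff d (elemSymm a * elemSymm b) = 0 := by
  rw [coeff_elemSymm_mul_elemSymm, Nat.cast_eq_zero, Nat.card_eq_zero]
  left
  refine ⟨?_⟩
  rintro ⟨⟨⟨s, hs⟩, ⟨t, ht⟩⟩, h⟩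
  refine hd ⟨fun x => ?_, ?_⟩
  · rw [← h x]
    split_ifs <;> simp
  · have : d = ∑ j ∈ s, Finsupp.single j 1 + ∑ j ∈ t, Finsupp.single j 1 := by
      ext x
      rw [Finsupp.add_apply, sum_single_one_apply, sum_single_one_apply]
      exact (h x).symm
    rw [this, map_add, map_sum, map_sum]
    simp [hs, ht]

theorem degree_eq_of_twos_ones (P Q : Finset ℕ+) (hPQ : Disjoint P Q) (d : ℕ+ →₀ ℕ)
    (hd : ∀ x, d x = if x ∈ P then 2 else if x ∈ Q then 1 else 0) :
    d.degree = 2 * P.card + Q.card := by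
  have : d = ∑ j ∈ P, Finsupp.single j 1 + ∑ j ∈ P, Finsupp.single j 1 +
      ∑ j ∈ Q, Finsupp.single j 1 := by
    ext x
    simp only [Finsupp.add_apply, sum_single_one_apply, hd]
    by_cases hx : x ∈ P
    · simp [hx, Finset.disjoint_left.1 hPQ hx]
    · simp [hx]
  rw [this]
  simp only [map_add, map_sum, Finsupp.degree_single, Finset.sum_const, smul_eq_mul]
  ring

/-- Both index sets must contain `P`, and each element of `Q` goes to exactly one of them; the
choice is which `b - |P|` elements of `Q` go to the second. -/
theorem coeff_elemSymm_mul_elemSymm_of_twos_ones (a b : ℕ) (P Q : Finset ℕ+)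
    (hPQ : Disjoint P Q) (d : ℕ+ →₀ ℕ)
    (hd : ∀ x, d x = if x ∈ P then 2 else if x ∈ Q then 1 else 0)
    (hab : 2 * P.card + Q.card = a + b) :
    MvPowerSeries.coeff d (elemSymm a * elemSymm b) =
      if P.card ≤ b then (Q.card.choose (b - P.card) : ℚ) else 0 := by
  rw [coeff_elemSymm_mul_elemSymm]
  have hdis := fun x (hx : x ∈ P) => Finset.disjoint_left.1 hPQ hx
  have hsub : ∀ s t : Finset ℕ+,
      (∀ j, (if j ∈ s then 1 else 0) + (if j ∈ t then 1 else 0) = d j) → P ⊆ t := by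
    intro s t h x hx
    have := h x
    rw [hd, if_pos hx] at this
    by_contra hxt
    rw [if_neg hxt] at this
    split_ifs at this <;> omega
  split_ifs with hb
  · rw [Nat.cast_inj, ← Finset.card_powersetCard, ← Nat.card_eq_finsetCard]
    symm
    refine Nat.card_eq_of_bijective (fun t => ⟨(⟨P ∪ (Q \ t.1), ?_⟩, ⟨P ∪ t.1, ?_⟩), ?_⟩) ⟨?_, ?_⟩
    · obtain ⟨h1, h2⟩ := Finset.mem_powersetCard.1 t.2
      have := Finset.card_sdiff_add_card_eq_card h1
      rw [Finset.card_union_of_disjoint (hPQ.mono_right Finset.sdiff_subset)]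
      omega
    · obtain ⟨h1, h2⟩ := Finset.mem_powersetCard.1 t.2
      rw [Finset.card_union_of_disjoint (hPQ.mono_right h1)]
      omega
    · intro x
      obtain ⟨h1, h2⟩ := Finset.mem_powersetCard.1 t.2
      have h1x := @h1 x
      rw [hd]
      simp only [Finset.mem_union, Finset.mem_sdiff]
      by_cases hxP : x ∈ P
      · simp [hxP]
      · by_cases hxt : x ∈ t.1
        · simp [hxP, hxt, h1x hxt]
        · simp [hxP, hxt]
    · intro t t' h
      have h' : P ∪ t.1 = P ∪ t'.1 := congrArg (fun y => y.1.2.1) h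
      have key : ∀ t : Q.powersetCard (b - P.card), (P ∪ t.1) \ P = t.1 := fun t =>
        Finset.union_sdiff_cancel_left (hPQ.mono_right (Finset.mem_powersetCard.1 t.2).1)
      exact Subtype.ext (by rw [← key t, ← key t', h'])
    · rintro ⟨⟨⟨s, hs⟩, ⟨t, ht⟩⟩, h⟩
      have hPt := hsub s t h
      have hcases : ∀ x, (x ∈ P → x ∈ s ∧ x ∈ t) ∧ (x ∈ Q → (x ∈ s ↔ x ∉ t)) ∧
          (x ∉ P → x ∉ Q → x ∉ s ∧ x ∉ t) := by
        intro x
        have h1 := h x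
        have h2 := hdis x
        rw [hd] at h1
        by_cases hxP : x ∈ P <;> by_cases hxQ : x ∈ Q <;> by_cases hxs : x ∈ s <;>
          by_cases hxt : x ∈ t <;> simp_all
      refine ⟨⟨t \ P, Finset.mem_powersetCard.2 ⟨fun x hx => ?_, ?_⟩⟩, ?_⟩
      · obtain ⟨hxt, hxP⟩ := Finset.mem_sdiff.1 hx
        by_contra hxQ
        exact ((hcases x).2.2 hxP hxQ).2 hxt
      · rw [Finset.card_sdiff_of_subset hPt, ht]
      · refine Subtype.ext (Prod.ext (Subtype.ext ?_) (Subtype.ext ?_))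
        · ext x
          have h1 := hcases x
          have h2 := hdis x
          simp only [Finset.mem_union, Finset.mem_sdiff]
          tauto
        · exact Finset.union_sdiff_of_subset hPt
  · rw [Nat.cast_eq_zero, Nat.card_eq_zero]
    left
    refine ⟨?_⟩
    rintro ⟨⟨⟨s, hs⟩, ⟨t, ht⟩⟩, h⟩
    have := Finset.card_le_card (hsub s t h)
    omega

/-- The expansion of the chromatic symmetric function of a graph without stable triples. -/
theorem chromaticSymm_eq_sum [Fintype V] (G : SimpleGraph V)
    (hG : ∀ a b c, a ≠ b → b ≠ c → a ≠ c → G.Adj a b ∨ G.Adj b c ∨ G.Adj a c) :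
    chromaticSymm G = ∑ i ∈ Finset.range (Fintype.card V + 1),
      (((removePair G ^ i) (uniqueSinkCount G) Finset.univ : ℤ) : ℚ) •
        (elemSymm (Fintype.card V - i) * elemSymm i) := by
  ext d
  rw [coeff_chromaticSymm, map_sum]
  simp only [MvPowerSeries.coeff_smul]
  by_cases hd : (∀ x, d x ≤ 2) ∧ d.degree = Fintype.card V
  · obtain ⟨hd2, hdeg⟩ := hd
    let P := d.support.filter fun x => d x = 2
    let Q := d.support.filter fun x => d x = 1
    have hPQ : Disjoint P Q := Finset.disjoint_left.2 fun x hP hQ => by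
      have h1 := (Finset.mem_filter.1 hP).2
      have h2 := (Finset.mem_filter.1 hQ).2
      omega
    have hdPQ : ∀ x, d x = if x ∈ P then 2 else if x ∈ Q then 1 else 0 := by
      intro x
      have := hd2 x
      simp only [P, Q, Finset.mem_filter, Finsupp.mem_support_iff]
      split_ifs <;> omega
    have hcard := degree_eq_of_twos_ones P Q hPQ d hdPQ
    have hP2 : ∀ x ∈ P, d x = 2 := fun x hx => (Finset.mem_filter.1 hx).2
    have hP1 : ∀ x ∉ P, d x ≤ 1 := fun x hx => by
      rw [hdPQ, if_neg hx]
      split_ifs <;> simp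
    have hn : Fintype.card V = 2 * P.card + Q.card := by omega
    have hleft : (colorCount G Finset.univ d : ℤ) =
        ∑ s ∈ Finset.range (P.card + Q.card + 1), (Q.card.choose s : ℤ) *
          (removePair G ^ (P.card + s)) (uniqueSinkCount G) Finset.univ := by
      rw [colorCount_eq_removePair_pow G P _ d hP2 hP1 (by rw [hdeg, Finset.card_univ]),
        removePair_pow_congr G P.card (g := ∑ s ∈ Finset.range (P.card + Q.card + 1),
          (Q.card.choose s : ℤ) • (removePair G ^ s) (uniqueSinkCount G))]
      · rw [map_sum, Finset.sum_apply]
        refine Finset.sum_congr rfl fun s _ => ?_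
        rw [map_smul, pow_add]
        rfl
      · intro T hT
        rw [Finset.card_univ] at hT
        have hTQ : T.card = Q.card := by omega
        rw [factorial_card_eq_sum G (P.card + Q.card + 1) T (by omega), Finset.sum_apply, hTQ]
        rfl
    -- Terms with `i < |P|` vanish because `e_i` must supply every squared variable; the others are
    -- reindexed by `i = |P| + s`.
    have hsplit : Fintype.card V + 1 = P.card + (P.card + Q.card + 1) := by omega
    rw [hsplit, Finset.sum_range_add _ P.card, Finset.sum_eq_zero, zero_add, ← Int.cast_natCast,
      hleft, Int.cast_sum]
    · refine Finset.sum_congr rfl fun s hs => ?_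
      rw [Finset.mem_range] at hs
      rw [coeff_elemSymm_mul_elemSymm_of_twos_ones _ _ P Q hPQ d hdPQ (by omega),
        if_pos (Nat.le_add_right _ _), Nat.add_sub_cancel_left, mul_comm]
      push_cast
      rfl
    · intro i hi
      rw [Finset.mem_range] at hi
      rw [coeff_elemSymm_mul_elemSymm_of_twos_ones _ _ P Q hPQ d hdPQ (by omega),
        if_neg (by omega), mul_zero]
  · rw [colorCount_univ_eq_zero G hG d hd, Nat.cast_zero, Finset.sum_eq_zero]
    intro i hi
    rw [Finset.mem_range] at hi
    rw [coeff_elemSymm_mul_elemSymm_eq_zero, mul_zero]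
    rwa [Nat.sub_add_cancel (by omega)]

end Counting

/-! ### The two cases and the structural dichotomy. -/

theorem ePositive_of_no_stable_triple {V : Type*} [Fintype V] (G : SimpleGraph V)
    (hG : ∀ a b c, a ≠ b → b ≠ c → a ≠ c → G.Adj a b ∨ G.Adj b c ∨ G.Adj a c) :
    EPositive (chromaticSymm G) := by
  classical
  rw [chromaticSymm_eq_sum G hG]
  refine EPositive.sum _ fun i _ => ((EPositive.elemSymm _).mul (EPositive.elemSymm _)).smul ?_
  exact Int.cast_nonneg (removePair_pow_nonneg G i (uniqueSinkCount_nonneg G hG) _)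

/-- In a (claw, co-paw)-free graph, a vertex has at most one neighbor in a stable triple. -/
theorem not_adj_of_adj_of_stable_triple {V : Type*} (G : SimpleGraph V)
    (hclaw : InducedFree clawGraph G) (hcopaw : InducedFree coPawGraph G) {a b c v : V}
    (hab : a ≠ b) (hbc : b ≠ c) (hac : a ≠ c) (hab' : ¬ G.Adj a b) (hbc' : ¬ G.Adj b c)
    (hac' : ¬ G.Adj a c) (hva : G.Adj v a) : ¬ G.Adj v b := by
  intro hvb
  have hva' := hva.ne
  have hvb' := hvb.ne
  have hvc' : v ≠ c := by
    rintro rfl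
    exact hac' hva.symm
  -- If `v` sees `c` too, it is the center of a claw; otherwise the path `a, v, b` and the isolated
  -- `c` form a co-paw.
  by_cases hvc : G.Adj v c
  · have hinj : Function.Injective (Sum.elim (fun _ => v) ![a, b, c] : Fin 1 ⊕ Fin 3 → V) := by
      rintro (i | i) (j | j) h <;> fin_cases i <;> fin_cases j <;> simp_all [Ne.symm]
    have hadj : ∀ i j, G.Adj ((Sum.elim (fun _ => v) ![a, b, c] : Fin 1 ⊕ Fin 3 → V) i)
        ((Sum.elim (fun _ => v) ![a, b, c] : Fin 1 ⊕ Fin 3 → V) j) ↔ clawGraph.Adj i j := by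
      rintro (i | i) (j | j) <;> fin_cases i <;> fin_cases j <;>
        simp_all [clawGraph, G.adj_comm]
    exact hclaw ⟨⟨⟨_, hinj⟩, fun {i j} => hadj i j⟩⟩
  · have hinj : Function.Injective ![a, b, c, v] := by
      intro i j h
      fin_cases i <;> fin_cases j <;> simp_all [Ne.symm]
    have hadj : ∀ i j, G.Adj (![a, b, c, v] i) (![a, b, c, v] j) ↔ coPawGraph.Adj i j := by
      intro i j
      fin_cases i <;> fin_cases j <;> simp_all [coPawGraph, pawGraph, G.adj_comm]
    exact hcopaw ⟨⟨⟨_, hinj⟩, fun {i j} => hadj i j⟩⟩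

/-- If `x, y, z` were an induced path, the closed neighborhoods of `x` and `z` would cover the
graph: a vertex outside both would form with `x, z` a stable triple in which `y` has two neighbors.
Each closed neighborhood holds at most one of `a, b, c`, contradicting the pigeonhole principle. -/
theorem adj_trans_of_stable_triple {V : Type*} (G : SimpleGraph V)
    (hclaw : InducedFree clawGraph G) (hcopaw : InducedFree coPawGraph G) {a b c : V}
    (hab : a ≠ b) (hbc : b ≠ c) (hac : a ≠ c) (hab' : ¬ G.Adj a b) (hbc' : ¬ G.Adj b c)
    (hac' : ¬ G.Adj a c) (x y z : V) (hxz : x ≠ z) (hxy : G.Adj x y) (hyz : G.Adj y z) :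
    G.Adj x z := by
  have key := fun {a b c v : V} => not_adj_of_adj_of_stable_triple G hclaw hcopaw
    (a := a) (b := b) (c := c) (v := v)
  by_contra hxz'
  have hcov : ∀ w, (w = x ∨ G.Adj x w) ∨ (w = z ∨ G.Adj z w) := by
    intro w
    by_contra! h
    obtain ⟨⟨hwx, hxw⟩, hwz, hzw⟩ := h
    exact key hxz (Ne.symm hwz) (Ne.symm hwx) hxz' hzw hxw hxy.symm hyz
  have htwo : ∀ a b c u : V, a ≠ b → b ≠ c → a ≠ c → ¬ G.Adj a b → ¬ G.Adj b c → ¬ G.Adj a c →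
      (a = u ∨ G.Adj u a) → ¬ (b = u ∨ G.Adj u b) := by
    rintro a b c u hab hbc hac hab' hbc' hac' (rfl | hua) (rfl | hub)
    · exact hab rfl
    · exact hab' hub
    · exact hab' hua.symm
    · exact key hab hbc hac hab' hbc' hac' hua hub
  have h1 := fun u => htwo a b c u hab hbc hac hab' hbc' hac'
  have h2 := fun u => htwo b c a u hbc hac.symm hab.symm hbc' (fun h => hac' h.symm)
    fun h => hab' h.symm
  have h3 := fun u => htwo a c b u hac hbc.symm hab hac' (fun h => hbc' h.symm) hab'
  rcases hcov a with ha | ha <;> rcases hcov b with hb | hb <;> rcases hcov c with hc | hc <;>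
    first
    | exact h1 _ ha hb
    | exact h2 _ hb hc
    | exact h3 _ ha hc

theorem mainTheorem2 {V : Type*} [Fintype V] (G : SimpleGraph V)
    (hclaw : InducedFree clawGraph G) (hcopaw : InducedFree coPawGraph G) :
    EPositive (chromaticSymm G) := by
  by_cases h : ∀ a b c, a ≠ b → b ≠ c → a ≠ c → G.Adj a b ∨ G.Adj b c ∨ G.Adj a c
  · exact ePositive_of_no_stable_triple G h
  · push Not at h
    obtain ⟨a, b, c, hab, hbc, hac, hab', hbc', hac'⟩ := h
    exact ePositive_of_adj_trans G
      (adj_trans_of_stable_triple G hclaw hcopaw hab hbc hac hab' hbc' hac')
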